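/- Let $n\ge 0$ and let $T=\{t_1,\dots,t_n\}\subset\mathbb{Q}[z_1,\dots,z_n]$ be a triangular set: for every $i$, the largest variable occurring in $t_i$ is $z_i$, $t_i$ is monic as a polynomial in $z_i$, of degree $d_i\ge 1$ in $z_i$, and $\deg_{z_j}(t_i)<d_j$ for all $j<i$. (So $T$ is zero-dimensional; in particular all $t_i$ may have integer coefficients.) Assume that the ideal $\langle T\rangle$ is radical, and let $R=\mathbb{Q}[z_1,\dots,z_n]/\langle T\rangle$. Every element of $R$ is represented by a unique reduced polynomial, that is, one of degree less than $d_i$ in $z_i$ for every $i$. For $f\in R[x]$ let $\mathrm{den}(f)$ be the least positive integer $d$ such that the reduced representatives of all coefficients of $d f$ have integer coefficients. A prime number $p$ is a radical prime for $T$ if $p$ divides no denominator of a coefficient of any $t_i$ and the ideal of $\mathbb{F}_p[z_1,\dots,z_n]$ generated by $T \bmod p$ is radical; otherwise it is nonradical. Let $f,u\in R[x]$ be monic with $u\mid f$ in $R[x]$, and let $$S=\{p \text{ prime} : p \text{ is a nonradical prime for } T, \text{ or } p\mid \mathrm{den}(f)\}.$$ Let $F_S\subset\mathbb{Q}[z_1,\dots,z_n]$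 be the localization of $F=\mathbb{Z}[z_1,\dots,z_n]$ at $S$, that is, the ring of all $Q/m$ with $Q\in F$ and $m$ a product of elements of $S$. Then $u\in F_S[x]/T$, that is, $u$ lies in the image of $F_S[x]\to R[x]$. In particular, every prime dividing $\mathrm{den}(u)$ is a nonradical prime for $T$ or divides $\mathrm{den}(f)$. -/

import Mathlib

open Polynomial

/-- The main degree of the `i`-th polynomial of the family `t`: its degree in the variable `z_i`. -/
noncomputable def mdeg {n : ℕ} {k : Type*} [Field k]
    (t : Fin n → MvPolynomial (Fin n) k) (i : Fin n) : ℕ :=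
  (t i).degreeOf i

/-- `t_1, …, t_n` is a (reduced, zero-dimensional) triangular set in `k[z_1, …, z_n]`: the main
variable of `t_i` is `z_i`, `t_i` is monic in `z_i`, and `deg_{z_j} t_i < mdeg t_j` for `j < i`.
Having one polynomial for each variable is what makes it zero-dimensional; for `n = 0` it is the
empty set. -/
structure IsTriangularSet {n : ℕ} {k : Type*} [Field k]
    (t : Fin n → MvPolynomial (Fin n) k) : Prop where
  /-- `z_i` occurs in `t_i` -/
  mdeg_pos : ∀ i, 0 < mdeg t i
  /-- no variable larger than `z_i` occurs in `t_i` -/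
  mvar_le : ∀ i j, i < j → (t i).degreeOf j = 0
  /-- `t_i = z_i ^ d` plus terms of degree less than `d` in `z_i`, where `d = mdeg t_i` -/
  monic : ∀ i, (t i - MvPolynomial.X i ^ mdeg t i).degreeOf i < mdeg t i
  /-- reducedness -/
  reduced : ∀ i j, j < i → (t i).degreeOf j < mdeg t j

/-- The ideal `⟨T⟩` of `k[z_1, …, z_n]`. -/
noncomputable def triIdeal {n : ℕ} {k : Type*} [Field k] (t : Fin n → MvPolynomial (Fin n) k) :
    Ideal (MvPolynomial (Fin n) k) :=
  Ideal.span (Set.range t)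

/-- The ring `R = k[z_1, …, z_n] / ⟨T⟩`. -/
abbrev TriRing {n : ℕ} {k : Type*} [Field k] (t : Fin n → MvPolynomial (Fin n) k) : Type _ :=
  MvPolynomial (Fin n) k ⧸ triIdeal t

/-- Coefficientwise reduction modulo `p` of a rational polynomial, `a / b ↦ a * b⁻¹`. It is only
used when `p` is a prime that divides no denominator of a coefficient. -/
noncomputable def reduceMod {n : ℕ} (p : ℕ) (P : MvPolynomial (Fin n) ℚ) :
    MvPolynomial (Fin n) (ZMod p) :=
  ∑ m ∈ P.support, MvPolynomial.monomial m
    (((P.coeff m).num : ZMod p) * ((P.coeff m).den : ZMod p)⁻¹)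

/-- `p` is a radical prime for `T`: it divides no denominator of a coefficient of a `t_i`, and the
ideal of `𝔽_p[z_1, …, z_n]` generated by `T mod p` is radical. -/
def IsRadicalPrime {n : ℕ} (t : Fin n → MvPolynomial (Fin n) ℚ) (p : ℕ) : Prop :=
  p.Prime ∧ (∀ i m, ¬ p ∣ ((t i).coeff m).den) ∧
    (Ideal.span (Set.range fun i => reduceMod p (t i))).IsRadical

/-- `d * f` is represented, coefficient by coefficient, by polynomials with integer coefficients
that are reduced modulo `T` (of degree less than `mdeg t_i` in each `z_i`). -/
def ClearsDenominators {n : ℕ} (t : Fin n → MvPolynomial (Fin n) ℚ) (f : (TriRing t)[X])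
    (d : ℕ) : Prop :=
  ∀ k, ∃ Q : MvPolynomial (Fin n) ℤ, (∀ i, Q.degreeOf i < mdeg t i) ∧
    Ideal.Quotient.mk (triIdeal t) (MvPolynomial.map (Int.castRingHom ℚ) Q) =
      (d : TriRing t) * f.coeff k

/-- `den(f)` for `f ∈ R[x]`: the least positive integer `d` such that `d * f` has integer
coefficients when the elements of `R` are written as reduced polynomials modulo `T`, that is, the
least common denominator of all rational numbers in the canonical form of `f`. -/
noncomputable def den {n : ℕ} (t : Fin n → MvPolynomial (Fin n) ℚ) (f : (TriRing t)[X]) : ℕ :=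
  sInf {d : ℕ | 0 < d ∧ ClearsDenominators t f d}

/-- A rational polynomial has a common denominator. -/
theorem exists_common_denominator {n : ℕ} (P : MvPolynomial (Fin n) ℚ) :
    ∃ d : ℕ, 0 < d ∧ ∃ Q : MvPolynomial (Fin n) ℤ,
      MvPolynomial.map (Int.castRingHom ℚ) Q = MvPolynomial.C (d : ℚ) * P ∧
        Q.support ⊆ P.support := by
  classical
  refine ⟨∏ m ∈ P.support, (P.coeff m).den, Finset.prod_pos fun m _ => (P.coeff m).den_pos,
    ∑ m ∈ P.support, MvPolynomial.monomial m
      ((P.coeff m).num * ∏ l ∈ P.support.erase m, ((P.coeff l).den : ℤ)), ?_, ?_⟩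
  · trans MvPolynomial.C ((∏ m ∈ P.support, (P.coeff m).den : ℕ) : ℚ) *
      ∑ m ∈ P.support, MvPolynomial.monomial m (P.coeff m)
    swap
    · rw [← P.as_sum]
    rw [map_sum, Finset.mul_sum]
    refine Finset.sum_congr rfl fun m hm => ?_
    rw [MvPolynomial.map_monomial, MvPolynomial.C_mul_monomial]
    congr 1
    rw [← Finset.mul_prod_erase _ _ hm]
    push_cast
    have h : (P.coeff m * (P.coeff m).den : ℚ) = (P.coeff m).num := Rat.mul_den_eq_num _
    simp only [eq_intCast]
    push_cast
    rw [← h]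
    ring
  · intro m hm
    by_contra hP
    apply MvPolynomial.mem_support_iff.mp hm
    rw [MvPolynomial.coeff_sum]
    refine Finset.sum_eq_zero fun l hl => ?_
    rw [MvPolynomial.coeff_monomial, if_neg]
    rintro rfl
    exact hP hl

/-- Every polynomial is congruent modulo a triangular set to a reduced polynomial. -/
theorem IsTriangularSet.exists_reduced {n : ℕ} {k : Type*} [Field k]
    {t : Fin n → MvPolynomial (Fin n) k} (ht : IsTriangularSet t) (P : MvPolynomial (Fin n) k) :
    ∃ r : MvPolynomial (Fin n) k, (∀ i, r.degreeOf i < mdeg t i) ∧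
      Ideal.Quotient.mk (triIdeal t) r = Ideal.Quotient.mk (triIdeal t) P := by
  let m : MonomialOrder (Fin n) := (MonomialOrder.lex : MonomialOrder (Fin n)ᵒᵈ)
  have hq : ∀ i, ∀ c ∈ (t i - MvPolynomial.X i ^ mdeg t i).support,
      m.toSyn c < m.toSyn (Finsupp.single i (mdeg t i)) := by
    intro i c hc
    refine (MonomialOrder.lex_lt_iff (σ := (Fin n)ᵒᵈ)).mpr (Finsupp.Lex.lt_iff.mpr
      ⟨OrderDual.toDual i, fun j hj => ?_, ?_⟩)
    · have hj' : i < OrderDual.ofDual j := hj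
      have h1 := MvPolynomial.monomial_le_degreeOf (OrderDual.ofDual j) hc
      have h2 := MvPolynomial.degreeOf_sub_le (OrderDual.ofDual j) (t i)
        (MvPolynomial.X i ^ mdeg t i)
      have h3 : (MvPolynomial.X i ^ mdeg t i : MvPolynomial (Fin n) k).degreeOf
          (OrderDual.ofDual j) = 0 := by
        classical
        have := MvPolynomial.degreeOf_pow_le (OrderDual.ofDual j)
          (MvPolynomial.X i : MvPolynomial (Fin n) k) (mdeg t i)
        rw [MvPolynomial.degreeOf_X_of_ne hj'.ne'] at this
        omega
      rw [ht.mvar_le i _ hj', h3] at h2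
      have h4 : c (OrderDual.ofDual j) = 0 := by simp at h2; omega
      have h5 : (Finsupp.single i (mdeg t i)) (OrderDual.ofDual j) = 0 :=
        Finsupp.single_eq_of_ne hj'.ne'
      exact h4.trans h5.symm
    · have h1 := (MvPolynomial.monomial_le_degreeOf i hc).trans_lt (ht.monic i)
      have h5 : (Finsupp.single i (mdeg t i)) i = mdeg t i := Finsupp.single_eq_same
      exact h1.trans_eq h5.symm
  have hX : ∀ i, (MvPolynomial.X i ^ mdeg t i : MvPolynomial (Fin n) k) =
      MvPolynomial.monomial (Finsupp.single i (mdeg t i)) 1 := fun i =>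
    MvPolynomial.X_pow_eq_monomial
  have hdX : ∀ i, m.degree (MvPolynomial.X i ^ mdeg t i : MvPolynomial (Fin n) k) =
      Finsupp.single i (mdeg t i) := by
    classical
    intro i
    rw [hX, m.degree_monomial, if_neg one_ne_zero]
  have hlt : ∀ i, m.toSyn (m.degree (t i - MvPolynomial.X i ^ mdeg t i)) <
      m.toSyn (m.degree (MvPolynomial.X i ^ mdeg t i : MvPolynomial (Fin n) k)) := by
    intro i
    rw [hdX]
    refine (m.degree_lt_iff ?_).mpr (hq i)
    rw [map_zero, m.toSyn_lt_iff_ne_zero]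
    intro h
    rw [m.toSyn_eq_zero_iff, Finsupp.single_eq_zero] at h
    exact (ht.mdeg_pos i).ne' h
  have ht' : ∀ i, t i = MvPolynomial.X i ^ mdeg t i + (t i - MvPolynomial.X i ^ mdeg t i) :=
    fun i => by ring
  have hdeg : ∀ i, m.degree (t i) = Finsupp.single i (mdeg t i) := by
    intro i
    rw [← hdX i, ← m.degree_add_of_lt (hlt i), ← ht' i]
  have hlead : ∀ i, IsUnit (m.leadingCoeff (t i)) := by
    intro i
    rw [ht' i, m.leadingCoeff_add_of_lt (hlt i), hX, m.leadingCoeff_monomial]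
    exact isUnit_one
  obtain ⟨g, r, hP, -, hr⟩ := m.div hlead P
  refine ⟨r, fun i => ?_, ?_⟩
  · rw [MvPolynomial.degreeOf_lt_iff (ht.mdeg_pos i)]
    intro c hc
    have := hr c hc i
    rw [hdeg] at this
    by_contra hle
    apply this
    rw [Finsupp.single_le_iff]
    omega
  · rw [eq_comm, Ideal.Quotient.eq, hP, add_sub_cancel_right, Finsupp.linearCombination_apply]
    refine Ideal.sum_mem _ fun i _ => ?_
    exact Ideal.mul_mem_left _ _ (Ideal.subset_span ⟨i, rfl⟩)

/-- The denominator of a polynomial over `R` is a positive integer that clears denominators. -/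
theorem den_spec {n : ℕ} {t : Fin n → MvPolynomial (Fin n) ℚ} (ht : IsTriangularSet t)
    (f : (TriRing t)[X]) : 0 < den t f ∧ ClearsDenominators t f (den t f) := by
  classical
  have key : ∀ k, ∃ d : ℕ, 0 < d ∧ ∃ Q : MvPolynomial (Fin n) ℤ,
      (∀ i, Q.degreeOf i < mdeg t i) ∧
      Ideal.Quotient.mk (triIdeal t) (MvPolynomial.map (Int.castRingHom ℚ) Q) =
        (d : TriRing t) * f.coeff k := by
    intro k
    obtain ⟨P, hP⟩ := Ideal.Quotient.mk_surjective (f.coeff k)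
    obtain ⟨r, hr, hrP⟩ := ht.exists_reduced P
    obtain ⟨d, hd, Q, hQ, hsupp⟩ := exists_common_denominator r
    refine ⟨d, hd, Q, fun i => ?_, ?_⟩
    · rw [MvPolynomial.degreeOf_lt_iff (ht.mdeg_pos i)]
      exact fun c hc => (MvPolynomial.degreeOf_lt_iff (ht.mdeg_pos i)).mp (hr i) c (hsupp hc)
    · rw [hQ, map_mul, hrP, hP, map_natCast, map_natCast]
  choose d hd Q hQ hQf using key
  refine Nat.sInf_mem (s := {d : ℕ | 0 < d ∧ ClearsDenominators t f d})
    ⟨∏ k ∈ f.support, d k, Finset.prod_pos fun k _ => hd k, fun k => ?_⟩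
  by_cases hk : k ∈ f.support
  · refine ⟨MvPolynomial.C ((∏ l ∈ f.support.erase k, d l : ℕ) : ℤ) * Q k, fun i => ?_, ?_⟩
    · exact (MvPolynomial.degreeOf_C_mul_le _ _ _).trans_lt (hQ k i)
    · rw [map_mul, map_mul, hQf, ← Finset.mul_prod_erase _ _ hk]
      simp only [map_natCast]
      push_cast
      ring
  · refine ⟨0, fun i => ?_, ?_⟩
    · rw [MvPolynomial.degreeOf_zero]
      exact ht.mdeg_pos i
    · rw [Polynomial.notMem_support_iff.mp hk]
      simp

/-- `F_S`, the localization of `F = ℤ[z_1, …, z_n]` at a set `S` of prime numbers, realized in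
`ℚ[z_1, …, z_n]`: the fractions `Q / d` with `Q ∈ F` and `d` a product of elements of `S`. -/
noncomputable def locPoly (n : ℕ) (S : Set ℕ) : Subring (MvPolynomial (Fin n) ℚ) where
  carrier := {P | ∃ d ∈ Submonoid.closure S, d ≠ 0 ∧ ∃ Q : MvPolynomial (Fin n) ℤ,
    MvPolynomial.C (d : ℚ) * P = MvPolynomial.map (Int.castRingHom ℚ) Q}
  one_mem' := ⟨1, one_mem _, one_ne_zero, 1, by simp⟩
  zero_mem' := ⟨1, one_mem _, one_ne_zero, 0, by simp⟩
  mul_mem' := by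
    rintro a b ⟨d, hd, hd0, Q, hQ⟩ ⟨e, he, he0, Q', hQ'⟩
    refine ⟨d * e, mul_mem hd he, mul_ne_zero hd0 he0, Q * Q', ?_⟩
    rw [map_mul, ← hQ, ← hQ']
    push_cast
    rw [map_mul]
    ring
  add_mem' := by
    rintro a b ⟨d, hd, hd0, Q, hQ⟩ ⟨e, he, he0, Q', hQ'⟩
    refine ⟨d * e, mul_mem hd he, mul_ne_zero hd0 he0,
      MvPolynomial.C (e : ℤ) * Q + MvPolynomial.C (d : ℤ) * Q', ?_⟩
    rw [map_add, map_mul, map_mul, ← hQ, ← hQ', MvPolynomial.map_C, MvPolynomial.map_C]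
    simp only [map_natCast]
    push_cast
    ring
  neg_mem' := by
    rintro a ⟨d, hd, hd0, Q, hQ⟩
    exact ⟨d, hd, hd0, -Q, by rw [map_neg, ← hQ]; ring⟩

/-- The natural map `F_S → R`, whose image is `F_S / ⟨T⟩`. -/
noncomputable def locToTriRing {n : ℕ} (t : Fin n → MvPolynomial (Fin n) ℚ) (S : Set ℕ) :
    locPoly n S →+* TriRing t :=
  (Ideal.Quotient.mk (triIdeal t)).comp (locPoly n S).subtype

/-- The set `S` of the primes that are nonradical for `T` or divide `den(f)`. -/
def badPrimes {n : ℕ} (t : Fin n → MvPolynomial (Fin n) ℚ) (f : (TriRing t)[X]) : Set ℕ :=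
  {p | p.Prime ∧ (¬ IsRadicalPrime t p ∨ p ∣ den t f)}

/-! The argument is local at one prime. Let `p` be a radical prime not dividing `den t f`, let `A =
ℤ_(p)` and `B = A[z] / ⟨T⟩`. Division with remainder by the monic family `T` works over `A` and its
remainders are unique, so `B` embeds in `R`, and `R = B[1/p]`. The polynomial `f` has coefficients
in `B`, hence the coefficients of its monic divisor `u` are integral over `B`.

Radicality of `p` says that `B / pB = 𝔽_p[z] / ⟨T mod p⟩` is reduced. This makes `B` integrally
closed in `B[1/p]`: if `y` is integral of degree `N` and `b = p y` lies in `B`, then multiplying the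
equation of `y` by `p ^ N` gives `p ∣ b ^ N`, so `p ∣ b` and `y ∈ B`
(`RingHom.IsIntegralElem.mem_range_of_pow_mul`). Therefore `u` has coefficients in `B`, their
reduced representatives are `p`-integral (`exists_reduced_not_dvd_den`), and minimality of `den t u`
forces `p ∤ den t u` (`not_dvd_den`). All prime factors of `den t u` thus lie in `S`, and dividing
by `den t u` exhibits `u` over `F_S`. -/

/-! ### Triangular families over a commutative ring: existence of remainders. -/

/-- The shape of a family `t_1, …, t_n` of polynomials over a commutative ring needed to divide by
it with remainder: `t_i` is monic of degree `d_i` in `z_i` and contains no larger variable. -/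
structure IsMonicTriangular {n : ℕ} {A : Type*} [CommRing A] (d : Fin n → ℕ)
    (t : Fin n → MvPolynomial (Fin n) A) : Prop where
  pos : ∀ i, 0 < d i
  mvar_le : ∀ i j, i < j → (t i).degreeOf j = 0
  monic : ∀ i, (t i - MvPolynomial.X i ^ d i).degreeOf i < d i

theorem IsTriangularSet.isMonicTriangular {n : ℕ} {k : Type*} [Field k]
    {t : Fin n → MvPolynomial (Fin n) k} (ht : IsTriangularSet t) :
    IsMonicTriangular (mdeg t) t :=
  ⟨ht.mdeg_pos, ht.mvar_le, ht.monic⟩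

theorem MvPolynomial.degreeOf_map_of_injective {σ A B : Type*} [CommSemiring A] [CommSemiring B]
    {φ : A →+* B} (hφ : Function.Injective φ) (P : MvPolynomial σ A) (i : σ) :
    (MvPolynomial.map φ P).degreeOf i = P.degreeOf i := by
  classical
  rw [MvPolynomial.degreeOf_def, MvPolynomial.degreeOf_def,
    MvPolynomial.degrees_map_of_injective _ hφ]

theorem IsMonicTriangular.of_map {n : ℕ} {A B : Type*} [CommRing A] [CommRing B] {φ : A →+* B}
    (hφ : Function.Injective φ) {d : Fin n → ℕ} {t : Fin n → MvPolynomial (Fin n) A}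
    (h : IsMonicTriangular d fun i => MvPolynomial.map φ (t i)) : IsMonicTriangular d t where
  pos := h.pos
  mvar_le i j hij := by
    rw [← MvPolynomial.degreeOf_map_of_injective hφ]
    exact h.mvar_le i j hij
  monic i := by
    rw [← MvPolynomial.degreeOf_map_of_injective hφ]
    simpa using h.monic i

/-- Division with remainder by a triangular family. -/
theorem IsMonicTriangular.exists_reduced {n : ℕ} {A : Type*} [CommRing A] [Nontrivial A]
    {d : Fin n → ℕ} {t : Fin n → MvPolynomial (Fin n) A} (ht : IsMonicTriangular d t)
    (P : MvPolynomial (Fin n) A) :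
    ∃ r : MvPolynomial (Fin n) A, (∀ i, r.degreeOf i < d i) ∧
      P - r ∈ Ideal.span (Set.range t) := by
  classical
  -- Lexicographic order with the indices reversed, so that `z_n` is the largest variable. The
  -- leading term of `t i` is then `z_i ^ d i` with coefficient `1`, and a remainder of multivariate
  -- division is exactly a reduced polynomial.
  let m : MonomialOrder (Fin n) := (MonomialOrder.lex : MonomialOrder (Fin n)ᵒᵈ)
  have hq : ∀ i, ∀ c ∈ (t i - MvPolynomial.X i ^ d i).support,
      m.toSyn c < m.toSyn (Finsupp.single i (d i)) := by
    intro i c hc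
    refine (MonomialOrder.lex_lt_iff (σ := (Fin n)ᵒᵈ)).mpr (Finsupp.Lex.lt_iff.mpr
      ⟨OrderDual.toDual i, fun j hj => ?_, ?_⟩)
    · have hj' : i < OrderDual.ofDual j := hj
      have h1 := MvPolynomial.monomial_le_degreeOf (OrderDual.ofDual j) hc
      have h2 := MvPolynomial.degreeOf_sub_le (OrderDual.ofDual j) (t i)
        (MvPolynomial.X i ^ d i)
      rw [ht.mvar_le i _ hj', MvPolynomial.degreeOf_X_pow_of_ne _ hj'.ne'] at h2
      have h4 : c (OrderDual.ofDual j) = 0 := by simp at h2; omega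
      exact h4.trans (Finsupp.single_eq_of_ne hj'.ne').symm
    · have h1 := (MvPolynomial.monomial_le_degreeOf i hc).trans_lt (ht.monic i)
      have h5 : (Finsupp.single i (d i)) i = d i := Finsupp.single_eq_same
      exact h1.trans_eq h5.symm
  have hX : ∀ i, (MvPolynomial.X i ^ d i : MvPolynomial (Fin n) A) =
      MvPolynomial.monomial (Finsupp.single i (d i)) 1 := fun i =>
    MvPolynomial.X_pow_eq_monomial
  have hdX : ∀ i, m.degree (MvPolynomial.X i ^ d i : MvPolynomial (Fin n) A) =
      Finsupp.single i (d i) := by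
    intro i
    rw [hX, m.degree_monomial, if_neg one_ne_zero]
  have hlt : ∀ i, m.toSyn (m.degree (t i - MvPolynomial.X i ^ d i)) <
      m.toSyn (m.degree (MvPolynomial.X i ^ d i : MvPolynomial (Fin n) A)) := by
    intro i
    rw [hdX]
    refine (m.degree_lt_iff ?_).mpr (hq i)
    rw [map_zero, m.toSyn_lt_iff_ne_zero]
    intro h
    rw [m.toSyn_eq_zero_iff, Finsupp.single_eq_zero] at h
    exact (ht.pos i).ne' h
  have ht' : ∀ i, t i = MvPolynomial.X i ^ d i + (t i - MvPolynomial.X i ^ d i) :=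
    fun i => by ring
  have hdeg : ∀ i, m.degree (t i) = Finsupp.single i (d i) := by
    intro i
    rw [← hdX i, ← m.degree_add_of_lt (hlt i), ← ht' i]
  have hlead : ∀ i, IsUnit (m.leadingCoeff (t i)) := by
    intro i
    rw [ht' i, m.leadingCoeff_add_of_lt (hlt i), hX, m.leadingCoeff_monomial]
    exact isUnit_one
  obtain ⟨g, r, hP, -, hr⟩ := m.div hlead P
  refine ⟨r, fun i => ?_, ?_⟩
  · rw [MvPolynomial.degreeOf_lt_iff (ht.pos i)]
    intro c hc
    have := hr c hc i
    rw [hdeg] at this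
    by_contra hle
    apply this
    rw [Finsupp.single_le_iff]
    omega
  · rw [hP, add_sub_cancel_right, Finsupp.linearCombination_apply]
    exact Ideal.sum_mem _ fun i _ => Ideal.mul_mem_left _ _ (Ideal.subset_span ⟨i, rfl⟩)

/-! ### Uniqueness of remainders. -/

/-- `A[z] → (A[z] / I)[X]`, sending `z_j` to `X` and every other `z_i` to its class. -/
noncomputable def separateVar {σ A : Type*} [DecidableEq σ] [CommRing A]
    (I : Ideal (MvPolynomial σ A)) (j : σ) :
    MvPolynomial σ A →+* (MvPolynomial σ A ⧸ I)[X] :=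
  MvPolynomial.eval₂Hom
    ((Polynomial.C.comp (Ideal.Quotient.mk I)).comp MvPolynomial.C)
    (fun i => if i = j then X else Polynomial.C (Ideal.Quotient.mk I (MvPolynomial.X i)))

section separateVar

variable {σ A : Type*} [DecidableEq σ] [CommRing A] (I : Ideal (MvPolynomial σ A)) (j : σ)

/-- Substituting the class of `z_j` for `X` undoes the separation, so a polynomial killed by
`separateVar I j` lies in `I`. The coefficient ring keeps an idle copy of `z_j`, which spares any
re-indexing of the variables. -/
theorem eval_separateVar (P : MvPolynomial σ A) :
    (separateVar I j P).eval (Ideal.Quotient.mk I (MvPolynomial.X j)) =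
      Ideal.Quotient.mk I P := by
  have : (Polynomial.evalRingHom (Ideal.Quotient.mk I (MvPolynomial.X j))).comp
      (separateVar I j) = Ideal.Quotient.mk I := by
    refine MvPolynomial.ringHom_ext (fun a => ?_) fun i => ?_
    · simp [separateVar]
    · by_cases h : i = j
      · simp [separateVar, h]
      · simp [separateVar, h]
  exact congrArg (fun f => f P) this

theorem natDegree_separateVar_le (P : MvPolynomial σ A) :
    (separateVar I j P).natDegree ≤ P.degreeOf j := by
  conv_lhs => rw [P.as_sum, map_sum]
  refine Polynomial.natDegree_sum_le_of_forall_le _ _ fun m hm => ?_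
  refine le_trans ?_ (MvPolynomial.monomial_le_degreeOf j hm)
  rw [separateVar, MvPolynomial.coe_eval₂Hom, MvPolynomial.eval₂_monomial]
  refine (Polynomial.natDegree_C_mul_le _ _).trans ?_
  refine (Polynomial.natDegree_prod_le _ _).trans ?_
  have : ∀ i ∈ m.support, ((if i = j then X else
      Polynomial.C (Ideal.Quotient.mk I (MvPolynomial.X i))) ^ m i).natDegree ≤
      if i = j then m j else 0 := by
    intro i _
    split_ifs with h
    · rw [h]
      exact Polynomial.natDegree_X_pow_le _
    · rw [← map_pow, Polynomial.natDegree_C]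
  refine (Finset.sum_le_sum this).trans ?_
  rw [Finset.sum_ite_eq']
  split_ifs <;> simp

theorem separateVar_of_degreeOf_eq_zero {P : MvPolynomial σ A} (hP : P.degreeOf j = 0) :
    separateVar I j P = Polynomial.C (Ideal.Quotient.mk I P) := by
  have h := natDegree_separateVar_le I j P
  rw [hP, Nat.le_zero] at h
  have h' := eval_separateVar I j P
  rw [Polynomial.eq_C_of_natDegree_eq_zero h] at h' ⊢
  rw [← h', Polynomial.eval_C]

end separateVar

/-- A reduced polynomial in the ideal of a triangular family vanishes. -/
theorem IsMonicTriangular.eq_zero_of_mem {n : ℕ} {A : Type*} [CommRing A]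
    {d : Fin n → ℕ} {t : Fin n → MvPolynomial (Fin n) A} (ht : IsMonicTriangular d t)
    {r : MvPolynomial (Fin n) A} (hr : ∀ i, r.degreeOf i < d i)
    (hmem : r ∈ Ideal.span (Set.range t)) : r = 0 := by
  -- The generators are discarded from the last one down, until `r` lies in the zero ideal.
  have key : ∀ k : ℕ, k ≤ n → r ∈ Ideal.span (t '' {i | (i : ℕ) < k}) → r = 0 := by
    intro k
    induction k with
    | zero => intro _ h; simpa using h
    | succ k ih =>
      intro hk h
      refine ih (by omega) ?_
      set I := Ideal.span (t '' {i : Fin n | (i : ℕ) < k}) with hI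
      let j : Fin n := ⟨k, hk⟩
      have hset : t '' {i : Fin n | (i : ℕ) < k + 1} = insert (t j) (t '' {i | (i : ℕ) < k}) := by
        rw [← Set.image_insert_eq]
        congr 1
        ext i
        simp only [Set.mem_ofPred_eq, Set.mem_insert_iff, Fin.ext_iff, j]
        omega
      rw [hset, Ideal.mem_span_insert] at h
      obtain ⟨g, w, hw, hrw⟩ := h
      -- The earlier generators do not involve `z_j`, so they map to constants that vanish modulo
      -- `I`.
      have hIw : separateVar I j w = 0 := by
        have : I ≤ RingHom.ker (separateVar I j) := by
          rw [hI, Ideal.span_le]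
          rintro _ ⟨i, hi, rfl⟩
          rw [SetLike.mem_coe, RingHom.mem_ker,
            separateVar_of_degreeOf_eq_zero _ _ (ht.mvar_le i j hi),
            Ideal.Quotient.eq_zero_iff_mem.mpr
              (Ideal.subset_span (Set.mem_image_of_mem t hi) : t i ∈ I), map_zero]
        exact this hw
      have hXj : separateVar I j (MvPolynomial.X j) = X := by simp [separateVar]
      have hdlt : ∀ {P : MvPolynomial (Fin n) A}, P.degreeOf j < d j →
          (separateVar I j P).degree < (d j : WithBot ℕ) := fun hP =>
        Polynomial.degree_le_natDegree.trans_lt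
          (by exact_mod_cast (natDegree_separateVar_le I j _).trans_lt hP)
      have htj : separateVar I j (t j) =
          X ^ d j + separateVar I j (t j - MvPolynomial.X j ^ d j) := by
        rw [map_sub, map_pow, hXj]
        ring
      have hmonic : (separateVar I j (t j)).Monic := by
        rw [htj]
        exact Polynomial.monic_X_pow_add (hdlt (ht.monic j))
      -- The degree of a monic polynomial is only meaningful over a nonzero ring; if the quotient is
      -- zero, `I` contains everything.
      rcases subsingleton_or_nontrivial (MvPolynomial (Fin n) A ⧸ I) with hs | hs
      · exact Ideal.Quotient.eq_zero_iff_mem.mp (Subsingleton.elim _ _)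
      have hdeg : (separateVar I j (t j)).degree = d j := by
        rw [htj, Polynomial.degree_add_eq_left_of_degree_lt, Polynomial.degree_X_pow]
        rw [Polynomial.degree_X_pow]
        exact hdlt (ht.monic j)
      -- Modulo `I`, `r` is a multiple of a monic polynomial of degree `d j` while its own degree is
      -- smaller.
      have hr0 : separateVar I j r = 0 := by
        by_contra h0
        refine hmonic.not_dvd_of_degree_lt h0 (hdeg ▸ hdlt (hr j)) ?_
        rw [hrw, map_add, map_mul, hIw, add_zero]
        exact ⟨separateVar I j g, mul_comm (separateVar I j g) (separateVar I j (t j))⟩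
      rw [← Ideal.Quotient.eq_zero_iff_mem, ← eval_separateVar I j, hr0, Polynomial.eval_zero]
  refine key n le_rfl ?_
  have : t '' {i : Fin n | (i : ℕ) < n} = Set.range t := by simp
  rwa [this]

/-- The ideal of a triangular family over a subring is contracted from the larger ring. -/
theorem IsMonicTriangular.map_mem_iff {n : ℕ} {A B : Type*} [CommRing A] [Nontrivial A]
    [CommRing B] {φ : A →+* B} (hφ : Function.Injective φ) {d : Fin n → ℕ}
    {t : Fin n → MvPolynomial (Fin n) A}
    (h : IsMonicTriangular d fun i => MvPolynomial.map φ (t i)) (P : MvPolynomial (Fin n) A) :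
    MvPolynomial.map φ P ∈ Ideal.span (Set.range fun i => MvPolynomial.map φ (t i)) ↔
      P ∈ Ideal.span (Set.range t) := by
  have hmap : ∀ Q ∈ Ideal.span (Set.range t), MvPolynomial.map φ Q ∈
      Ideal.span (Set.range fun i => MvPolynomial.map φ (t i)) := by
    intro Q hQ
    have := Ideal.mem_map_of_mem (MvPolynomial.map φ) hQ
    rwa [Ideal.map_span, ← Set.range_comp] at this
  refine ⟨fun hP => ?_, hmap P⟩
  -- The remainder over `A` stays reduced over `B` and lies in the ideal there, so it is zero by
  -- uniqueness.
  obtain ⟨r, hr, hPr⟩ := (IsMonicTriangular.of_map hφ h).exists_reduced P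
  have h0 : MvPolynomial.map φ r = 0 := by
    refine h.eq_zero_of_mem (fun i => ?_) ?_
    · rw [MvPolynomial.degreeOf_map_of_injective hφ]
      exact hr i
    · have := Ideal.sub_mem _ hP (hmap _ hPr)
      rwa [← map_sub, sub_sub_cancel] at this
  rw [map_eq_zero_iff _ (MvPolynomial.map_injective φ hφ)] at h0
  rwa [h0, sub_zero] at hPr

/-! ### Integral elements over a ring in which `p` generates a radical ideal. -/

/-- If `p` becomes invertible in `R` and generates a radical ideal of `B`, then elements of `R`
that are integral over `B` and have a multiple by a power of `p` in `B` lie in `B`. -/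
theorem RingHom.IsIntegralElem.mem_range_of_pow_mul {B R : Type*} [CommRing B] [CommRing R]
    {g : B →+* R} (hg : Function.Injective g) {p : B} (hp : IsUnit (g p))
    (hrad : ∀ (b : B) (m : ℕ), p ∣ b ^ m → p ∣ b) {c : R} (hc : g.IsIntegralElem c) (k : ℕ)
    (hk : g p ^ k * c ∈ g.range) : c ∈ g.range := by
  induction k generalizing c with
  | zero => simpa using hk
  | succ k ih =>
    refine ih hc ?_
    obtain ⟨b, hb⟩ := hk
    obtain ⟨F, hF, hF0⟩ : g.IsIntegralElem (g p ^ k * c) := by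
      rw [← map_pow]
      exact g.isIntegralElem_map.mul g hc
    -- Scaling the monic equation of `y = g p ^ k * c` by `p ^ natDegree F`, with `g b = g p * y`,
    -- shows that `p` divides `b ^ natDegree F`.
    obtain ⟨a, rfl⟩ := hrad b _ (Polynomial.dvd_pow_natDegree_of_eval₂_eq_zero hg hF p b _ hF0
      (by rw [hb]; ring))
    refine ⟨a, hp.mul_left_cancel ?_⟩
    rw [← map_mul, hb]
    ring

/-- In the situation of `RingHom.IsIntegralElem.mem_range_of_pow_mul`, monic divisors of monic
polynomials over `B` have coefficients in `B`. -/
theorem Polynomial.coeff_mem_range_of_dvd {B R : Type*} [CommRing B] [CommRing R]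
    {g : B →+* R} (hg : Function.Injective g) {p : B} (hp : IsUnit (g p))
    (hrad : ∀ (b : B) (m : ℕ), p ∣ b ^ m → p ∣ b)
    (hpow : ∀ c : R, ∃ k : ℕ, g p ^ k * c ∈ g.range) {f u : R[X]} (hf : f.Monic) (hu : u.Monic)
    (huf : u ∣ f) (hlift : f ∈ Polynomial.lifts g) (k : ℕ) : u.coeff k ∈ g.range := by
  obtain ⟨F, hF, -, hFm⟩ := Polynomial.lifts_and_natDegree_eq_and_monic hlift hf
  have hint : g.IsIntegralElem (u.coeff k) := by
    let _ := g.toAlgebra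
    exact Polynomial.isIntegral_coeff_of_dvd F u hFm hu (hF ▸ huf) k
  obtain ⟨e, he⟩ := hpow (u.coeff k)
  exact hint.mem_range_of_pow_mul hg hp hrad e he

/-- If `T mod π` generates a radical ideal, then `π` generates a radical ideal of `A[z] / ⟨T⟩`. -/
theorem MvPolynomial.quotient_dvd_of_dvd_pow {σ ι A k : Type*} [CommRing A] [CommRing k]
    {ψ : A →+* k} (hψ : Function.Surjective ψ) {π : A} (hπ : ψ π = 0)
    (hker : ∀ a, ψ a = 0 → π ∣ a) {t : ι → MvPolynomial σ A}
    (h : (Ideal.span (Set.range fun i => MvPolynomial.map ψ (t i))).IsRadical)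
    (b : MvPolynomial σ A ⧸ Ideal.span (Set.range t)) (m : ℕ)
    (hb : Ideal.Quotient.mk (Ideal.span (Set.range t)) (MvPolynomial.C π) ∣ b ^ m) :
    Ideal.Quotient.mk (Ideal.span (Set.range t)) (MvPolynomial.C π) ∣ b := by
  have hspan : Ideal.span (Set.range fun i => MvPolynomial.map ψ (t i)) =
      (Ideal.span (Set.range t)).map (MvPolynomial.map ψ) := by
    rw [Ideal.map_span, ← Set.range_comp]
    rfl
  obtain ⟨P, rfl⟩ := Ideal.Quotient.mk_surjective b
  obtain ⟨c, hc⟩ := hb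
  obtain ⟨Q, rfl⟩ := Ideal.Quotient.mk_surjective c
  rw [← map_pow, ← map_mul, Ideal.Quotient.eq] at hc
  have hP : MvPolynomial.map ψ P ∈ Ideal.span (Set.range fun i => MvPolynomial.map ψ (t i)) := by
    refine h ⟨m, ?_⟩
    rw [hspan]
    simpa [hπ] using Ideal.mem_map_of_mem (MvPolynomial.map ψ) hc
  rw [hspan, Ideal.mem_map_iff_of_surjective _ (MvPolynomial.map_surjective _ hψ)] at hP
  obtain ⟨W, hW, hWP⟩ := hP
  -- `W ∈ ⟨T⟩` has the same reduction as `P`, so every coefficient of `P - W` is a multiple of `π`.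
  obtain ⟨V, hV⟩ : MvPolynomial.C π ∣ P - W := by
    rw [MvPolynomial.C_dvd_iff_dvd_coeff]
    intro m
    refine hker _ ?_
    rw [← MvPolynomial.coeff_map, map_sub, hWP, sub_self, MvPolynomial.coeff_zero]
  refine ⟨Ideal.Quotient.mk _ V, ?_⟩
  rw [← map_mul, ← hV, Ideal.Quotient.eq]
  simpa using hW

/-! ### The lattice `A[z] / ⟨T⟩` inside `K[z] / ⟨T⟩`. -/

section latticeMap

variable {n : ℕ} {A K : Type*} [CommRing A] [Field K] (φ : A →+* K)
  (t : Fin n → MvPolynomial (Fin n) A)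

/-- The natural map `A[z] / ⟨T⟩ → K[z] / ⟨T⟩`. -/
noncomputable def latticeMap : MvPolynomial (Fin n) A ⧸ Ideal.span (Set.range t) →+*
    TriRing fun i => MvPolynomial.map φ (t i) :=
  Ideal.quotientMap _ (MvPolynomial.map φ) <| by
    rw [Ideal.span_le]
    rintro _ ⟨i, rfl⟩
    exact Ideal.subset_span ⟨i, rfl⟩

theorem latticeMap_mk (P : MvPolynomial (Fin n) A) :
    latticeMap φ t (Ideal.Quotient.mk _ P) = Ideal.Quotient.mk _ (MvPolynomial.map φ P) :=
  Ideal.quotientMap_mk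

variable {φ t}

theorem latticeMap_injective [Nontrivial A] (hφ : Function.Injective φ)
    (ht : IsTriangularSet fun i => MvPolynomial.map φ (t i)) :
    Function.Injective (latticeMap φ t) :=
  Ideal.quotientMap_injective' fun P hP =>
    (ht.isMonicTriangular.map_mem_iff hφ P).mp hP

/-- Let `A ⊆ K` with `K = A[1/π]`. If `T mod π` generates a radical ideal, then the coefficients of
monic divisors of monic polynomials over `A[z] / ⟨T⟩` have reduced representatives over `A`. -/
theorem exists_reduced_map_eq_coeff [Nontrivial A] (hφ : Function.Injective φ)
    (ht : IsTriangularSet fun i => MvPolynomial.map φ (t i)) {k : Type*} [CommRing k]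
    {ψ : A →+* k} (hψ : Function.Surjective ψ) {π : A} (hπ : ψ π = 0) (hφπ : φ π ≠ 0)
    (hker : ∀ a, ψ a = 0 → π ∣ a)
    (hrad : (Ideal.span (Set.range fun i => MvPolynomial.map ψ (t i))).IsRadical)
    (hpow : ∀ P : MvPolynomial (Fin n) K, ∃ (e : ℕ) (P' : MvPolynomial (Fin n) A),
      MvPolynomial.map φ P' = MvPolynomial.C (φ π ^ e) * P)
    {f u : (TriRing fun i => MvPolynomial.map φ (t i))[X]} (hf : f.Monic) (hu : u.Monic)
    (huf : u ∣ f) (hlift : ∀ j, ∃ P : MvPolynomial (Fin n) A,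
      Ideal.Quotient.mk _ (MvPolynomial.map φ P) = f.coeff j) (j : ℕ) :
    ∃ r : MvPolynomial (Fin n) A, (∀ i, r.degreeOf i < mdeg (fun i => MvPolynomial.map φ (t i)) i) ∧
      Ideal.Quotient.mk _ (MvPolynomial.map φ r) = u.coeff j := by
  have hunit : IsUnit (latticeMap φ t (Ideal.Quotient.mk _ (MvPolynomial.C π))) := by
    rw [latticeMap_mk, MvPolynomial.map_C, ← RingHom.comp_apply]
    exact (IsUnit.mk0 _ hφπ).map _
  have hrange : ∀ c, ∃ e : ℕ, latticeMap φ t (Ideal.Quotient.mk _ (MvPolynomial.C π)) ^ e * c ∈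
      (latticeMap φ t).range := by
    intro c
    obtain ⟨P, rfl⟩ := Ideal.Quotient.mk_surjective c
    obtain ⟨e, P', hP'⟩ := hpow P
    refine ⟨e, Ideal.Quotient.mk _ P', ?_⟩
    rw [latticeMap_mk, latticeMap_mk, hP', map_mul, MvPolynomial.map_C, map_pow, map_pow]
  have hlift' : f ∈ Polynomial.lifts (latticeMap φ t) := by
    rw [Polynomial.lifts_iff_coeff_lifts]
    intro j
    obtain ⟨P, hP⟩ := hlift j
    exact ⟨Ideal.Quotient.mk _ P, (latticeMap_mk φ t P).trans hP⟩
  obtain ⟨b, hb⟩ := Polynomial.coeff_mem_range_of_dvd (latticeMap_injective hφ ht) hunit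
    (MvPolynomial.quotient_dvd_of_dvd_pow hψ hπ hker hrad) hrange hf hu huf hlift' j
  obtain ⟨P, rfl⟩ := Ideal.Quotient.mk_surjective b
  -- An arbitrary representative over `A` need not be reduced; dividing over `A` reduces it without
  -- introducing denominators.
  obtain ⟨r, hr, hPr⟩ := (ht.isMonicTriangular.of_map hφ).exists_reduced P
  refine ⟨r, fun i => ?_, ?_⟩
  · exact hr i
  · rw [← hb, Ideal.Quotient.eq.mpr hPr, latticeMap_mk]

end latticeMap

/-! ### The ring `ℤ_(p)` and its residue field. -/

/-- The local ring `ℤ_(p)` as a subring of `ℚ`. -/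
def ratLocal (p : ℕ) [hp : Fact p.Prime] : Subring ℚ where
  carrier := {q | ¬ p ∣ q.den}
  one_mem' := by simpa using hp.out.one_lt.ne'
  zero_mem' := by simpa using hp.out.one_lt.ne'
  mul_mem' {a b} ha hb h :=
    (hp.out.dvd_mul.mp (h.trans (Rat.mul_den_dvd a b))).elim ha hb
  add_mem' {a b} ha hb h :=
    (hp.out.dvd_mul.mp (h.trans (Rat.add_den_dvd a b))).elim ha hb
  neg_mem' {a} ha h := ha (by simpa using h)

namespace ratLocal

variable {p : ℕ} [hp : Fact p.Prime]

theorem den_ne_zero (q : ratLocal p) : ((q : ℚ).den : ZMod p) ≠ 0 := fun h =>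
  q.2 ((ZMod.natCast_eq_zero_iff _ _).mp h)

/-- Reduction `ℤ_(p) → 𝔽_p`. -/
def residue (p : ℕ) [Fact p.Prime] : ratLocal p →+* ZMod p where
  toFun q := ((q : ℚ) : ZMod p)
  map_one' := by simp
  map_zero' := by simp
  map_mul' a b := by
    rw [Subring.coe_mul]
    exact Rat.cast_mul_of_ne_zero (den_ne_zero a) (den_ne_zero b)
  map_add' a b := by
    rw [Subring.coe_add]
    exact Rat.cast_add_of_ne_zero (den_ne_zero a) (den_ne_zero b)

/-- This is the coefficient formula of `reduceMod`, so the two reductions can be compared. -/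
theorem residue_apply (q : ratLocal p) :
    residue p q = ((q : ℚ).num : ZMod p) * ((q : ℚ).den : ZMod p)⁻¹ := by
  rw [← div_eq_mul_inv, ← Rat.cast_def]
  rfl

theorem intCast_div_mem (a : ℤ) {d : ℕ} (hd : ¬ p ∣ d) : (a / d : ℚ) ∈ ratLocal p := by
  intro h
  have h1 := Rat.den_dvd a d
  rw [Rat.divInt_eq_div, Int.cast_natCast] at h1
  exact hd (Int.natCast_dvd_natCast.mp ((Int.natCast_dvd_natCast.mpr h).trans h1))

theorem dvd_of_residue_eq_zero {q : ratLocal p} (h : residue p q = 0) : (p : ratLocal p) ∣ q := by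
  rw [residue_apply, mul_eq_zero, or_iff_left (inv_ne_zero (den_ne_zero q)),
    ZMod.intCast_zmod_eq_zero_iff_dvd] at h
  obtain ⟨a, ha⟩ := h
  refine ⟨⟨a / (q : ℚ).den, intCast_div_mem a q.2⟩, Subtype.ext ?_⟩
  rw [Subring.coe_mul, Subring.coe_natCast]
  conv_lhs => rw [← Rat.num_div_den (q : ℚ), ha]
  push_cast
  ring

theorem residue_surjective : Function.Surjective (residue p) := fun x => by
  obtain ⟨a, rfl⟩ := ZMod.intCast_surjective x
  exact ⟨a, map_intCast _ a⟩

/-- A rational polynomial with coefficients in `ℤ_(p)` lifts to `ℤ_(p)[z]`. -/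
theorem exists_map_eq {σ : Type*} (P : MvPolynomial σ ℚ) (h : ∀ m, ¬ p ∣ (P.coeff m).den) :
    ∃ P' : MvPolynomial σ (ratLocal p), MvPolynomial.map (ratLocal p).subtype P' = P := by
  refine ⟨∑ m ∈ P.support, MvPolynomial.monomial m ⟨P.coeff m, h m⟩, ?_⟩
  conv_rhs => rw [P.as_sum]
  simp [map_sum, MvPolynomial.map_monomial]

/-- Turns the radicality condition in `IsRadicalPrime` into one about the ring homomorphism `residue
p`. -/
theorem reduceMod_map {n : ℕ} (P : MvPolynomial (Fin n) (ratLocal p)) :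
    reduceMod p (MvPolynomial.map (ratLocal p).subtype P) = MvPolynomial.map (residue p) P := by
  conv_rhs => rw [P.as_sum]
  rw [reduceMod, MvPolynomial.support_map_of_injective _ Subtype.val_injective, map_sum]
  refine Finset.sum_congr rfl fun m _ => ?_
  rw [MvPolynomial.map_monomial, residue_apply, MvPolynomial.coeff_map]
  rfl

/-- A rational polynomial has a multiple by a power of `p` with coefficients in `ℤ_(p)`. -/
theorem exists_map_eq_pow_mul {σ : Type*} {P : MvPolynomial σ ℚ} {N : ℕ} (hN : N ≠ 0)
    {Q : MvPolynomial σ ℤ}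
    (h : MvPolynomial.map (Int.castRingHom ℚ) Q = MvPolynomial.C (N : ℚ) * P) :
    ∃ (k : ℕ) (P' : MvPolynomial σ (ratLocal p)),
      MvPolynomial.map (ratLocal p).subtype P' = MvPolynomial.C ((p : ℚ) ^ k) * P := by
  obtain ⟨k, d, hd, rfl⟩ := Nat.exists_eq_pow_mul_and_not_dvd hN p hp.out.ne_one
  have hd0 : (d : ℚ) ≠ 0 := Nat.cast_ne_zero.mpr fun h => hd (h ▸ dvd_zero p)
  refine ⟨k, exists_map_eq _ fun m => ?_⟩
  have hm := congrArg (MvPolynomial.coeff m) h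
  rw [MvPolynomial.coeff_map, MvPolynomial.coeff_C_mul] at hm
  have : MvPolynomial.coeff m (MvPolynomial.C ((p : ℚ) ^ k) * P) =
      ((MvPolynomial.coeff m Q : ℤ) : ℚ) / d := by
    rw [MvPolynomial.coeff_C_mul, eq_div_iff hd0, ← eq_intCast (Int.castRingHom ℚ), hm]
    push_cast
    ring
  rw [this]
  exact intCast_div_mem _ hd

end ratLocal

/-! ### Denominators at one prime, and the conclusion. -/

/-- Division by a positive integer in `R`. -/
theorem mk_C_inv_mul {n : ℕ} {t : Fin n → MvPolynomial (Fin n) ℚ} {d : ℕ} (hd : d ≠ 0)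
    {P : MvPolynomial (Fin n) ℚ} {c : TriRing t}
    (h : Ideal.Quotient.mk (triIdeal t) P = (d : TriRing t) * c) :
    Ideal.Quotient.mk (triIdeal t) (MvPolynomial.C (d : ℚ)⁻¹ * P) = c := by
  have hC : MvPolynomial.C (d : ℚ)⁻¹ * MvPolynomial.C (d : ℚ) =
      (1 : MvPolynomial (Fin n) ℚ) := by
    rw [← map_mul, inv_mul_cancel₀ (Nat.cast_ne_zero.mpr hd), map_one]
  rw [map_mul, h, ← mul_assoc,
    ← map_natCast ((Ideal.Quotient.mk (triIdeal t)).comp MvPolynomial.C) d,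
    RingHom.comp_apply, ← map_mul, hC, map_one, one_mul]

/-- At a radical prime that does not divide `den f`, the coefficients of a monic divisor of `f` have
`p`-integral reduced representatives. -/
theorem exists_reduced_not_dvd_den {n : ℕ} {t : Fin n → MvPolynomial (Fin n) ℚ}
    (ht : IsTriangularSet t) {f u : (TriRing t)[X]} (hf : f.Monic) (hu : u.Monic) (huf : u ∣ f)
    {p : ℕ} (hp : IsRadicalPrime t p) (hpf : ¬ p ∣ den t f) (k : ℕ) :
    ∃ P : MvPolynomial (Fin n) ℚ, (∀ i, P.degreeOf i < mdeg t i) ∧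
      (∀ m, ¬ p ∣ (P.coeff m).den) ∧ Ideal.Quotient.mk (triIdeal t) P = u.coeff k := by
  obtain ⟨hprime, hden, hrad⟩ := hp
  have := Fact.mk hprime
  choose t' ht' using fun i => ratLocal.exists_map_eq (p := p) (t i) (hden i)
  -- From here on `T` is literally the image of a family over `ℤ_(p)`, as `TriRing` in the lattice
  -- lemmas requires.
  obtain rfl : (fun i => MvPolynomial.map (ratLocal p).subtype (t' i)) = t := funext ht'
  simp only [ratLocal.reduceMod_map] at hrad
  have hpow : ∀ P : MvPolynomial (Fin n) ℚ, ∃ (e : ℕ) (P' : MvPolynomial (Fin n) (ratLocal p)),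
      MvPolynomial.map (ratLocal p).subtype P' =
        MvPolynomial.C ((ratLocal p).subtype (p : ratLocal p) ^ e) * P := by
    intro P
    obtain ⟨N, hN, Q, hQ, -⟩ := exists_common_denominator P
    simpa using ratLocal.exists_map_eq_pow_mul (p := p) hN.ne' hQ
  have hlift : ∀ j, ∃ P : MvPolynomial (Fin n) (ratLocal p),
      Ideal.Quotient.mk _ (MvPolynomial.map (ratLocal p).subtype P) = f.coeff j := by
    intro j
    obtain ⟨Q, -, hQ⟩ := (den_spec ht f).2 j
    obtain ⟨P, hP⟩ := ratLocal.exists_map_eq (p := p) (MvPolynomial.C (den _ f : ℚ)⁻¹ *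
      MvPolynomial.map (Int.castRingHom ℚ) Q) fun m => by
        rw [MvPolynomial.coeff_C_mul, MvPolynomial.coeff_map, mul_comm, ← div_eq_mul_inv]
        exact ratLocal.intCast_div_mem _ hpf
    exact ⟨P, by rw [hP]; exact mk_C_inv_mul (den_spec ht f).1.ne' hQ⟩
  obtain ⟨r, hr, hru⟩ := exists_reduced_map_eq_coeff (φ := (ratLocal p).subtype)
    Subtype.val_injective ht (ratLocal.residue_surjective (p := p)) (π := (p : ratLocal p))
    (by simp) (by simpa using hprime.ne_zero) (fun _ => ratLocal.dvd_of_residue_eq_zero) hrad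
    hpow hf hu huf hlift k
  refine ⟨MvPolynomial.map (ratLocal p).subtype r, fun i => ?_, fun m => ?_, hru⟩
  · rw [MvPolynomial.degreeOf_map_of_injective Subtype.val_injective]
    exact hr i
  · rw [MvPolynomial.coeff_map]
    exact (r.coeff m).2

/-- A prime divides `den u` only if some coefficient of `u` has no `p`-integral reduced
representative. -/
theorem not_dvd_den {n : ℕ} {t : Fin n → MvPolynomial (Fin n) ℚ} (ht : IsTriangularSet t)
    {u : (TriRing t)[X]} {p : ℕ} (hp : p.Prime)
    (h : ∀ k, ∃ P : MvPolynomial (Fin n) ℚ, (∀ i, P.degreeOf i < mdeg t i) ∧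
      (∀ m, ¬ p ∣ (P.coeff m).den) ∧ Ideal.Quotient.mk (triIdeal t) P = u.coeff k) :
    ¬ p ∣ den t u := by
  rintro ⟨e, he⟩
  obtain ⟨hpos, hclear⟩ := den_spec ht u
  have he0 : 0 < e := Nat.pos_of_ne_zero fun h0 => by simp [he, h0] at hpos
  have hlt : e < den t u := by
    rw [he]
    exact lt_mul_of_one_lt_left he0 hp.one_lt
  -- If `den t u = p * e`, then `e` already clears the denominators, against minimality.
  refine Nat.notMem_of_lt_sInf hlt ⟨he0, fun k => ?_⟩
  obtain ⟨Q, hQr, hQ⟩ := hclear k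
  obtain ⟨P, hPr, hPp, hP⟩ := h k
  -- Both sides are reduced and represent the same class, so they agree as polynomials.
  have hQP : MvPolynomial.map (Int.castRingHom ℚ) Q = MvPolynomial.C (den t u : ℚ) * P := by
    rw [← sub_eq_zero]
    refine ht.isMonicTriangular.eq_zero_of_mem (fun i => ?_) ?_
    · refine (MvPolynomial.degreeOf_sub_le _ _ _).trans_lt (max_lt ?_ ?_)
      · rw [MvPolynomial.degreeOf_map_of_injective (RingHom.injective_int _)]
        exact hQr i
      · exact (MvPolynomial.degreeOf_C_mul_le _ _ _).trans_lt (hPr i)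
    · change _ ∈ triIdeal t
      rw [← Ideal.Quotient.eq, hQ, map_mul, hP]
      simp only [map_natCast]
  -- Coefficientwise `Q = p * e * P`, and the denominators of `P` are prime to `p`.
  have hdvd : MvPolynomial.C (p : ℤ) ∣ Q := by
    rw [MvPolynomial.C_dvd_iff_dvd_coeff]
    intro m
    have hm : ((Q.coeff m : ℤ) : ℚ) = (p * e : ℕ) * P.coeff m := by
      rw [← he, ← MvPolynomial.coeff_C_mul, ← hQP, MvPolynomial.coeff_map]
      rfl
    have hm' : Q.coeff m * ((P.coeff m).den : ℤ) = p * (e * (P.coeff m).num) := by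
      have hd : ((P.coeff m).den : ℚ) ≠ 0 := by exact_mod_cast (P.coeff m).den_ne_zero
      rw [← Rat.num_div_den (P.coeff m)] at hm
      have : ((Q.coeff m : ℤ) : ℚ) * (P.coeff m).den = p * (e * (P.coeff m).num) := by
        conv_lhs => rw [hm]
        push_cast
        field_simp
      exact_mod_cast this
    refine ((Nat.prime_iff_prime_int.mp hp).dvd_or_dvd ⟨_, hm'⟩).resolve_right fun hd => ?_
    exact hPp m (Int.natCast_dvd_natCast.mp hd)
  obtain ⟨Q', rfl⟩ := hdvd
  have hQ' : MvPolynomial.map (Int.castRingHom ℚ) Q' = MvPolynomial.C (e : ℚ) * P := by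
    have hC : (MvPolynomial.C (p : ℚ) : MvPolynomial (Fin n) ℚ) ≠ 0 := by simpa using hp.ne_zero
    refine mul_left_cancel₀ hC ?_
    rw [he, map_mul, MvPolynomial.map_C] at hQP
    push_cast at hQP
    rw [map_mul, mul_assoc] at hQP
    simpa using hQP
  refine ⟨Q', fun i => ?_, ?_⟩
  · refine lt_of_le_of_lt ?_ (hPr i)
    rw [← MvPolynomial.degreeOf_map_of_injective (RingHom.injective_int (Int.castRingHom ℚ)), hQ']
    exact MvPolynomial.degreeOf_C_mul_le _ _ _
  · rw [hQ', map_mul, hP]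
    simp only [map_natCast]

/-- A natural number whose prime factors all lie in `S` is a product of elements of `S`. -/
theorem Nat.mem_closure_of_forall_prime_dvd {S : Set ℕ} {d : ℕ} (hd : d ≠ 0)
    (h : ∀ p : ℕ, p.Prime → p ∣ d → p ∈ S) : d ∈ Submonoid.closure S := by
  rw [← Nat.prod_primeFactorsList hd]
  exact Submonoid.list_prod_mem _ fun p hp => Submonoid.subset_closure
    (h p (Nat.prime_of_mem_primeFactorsList hp) (Nat.dvd_of_mem_primeFactorsList hp))

theorem lemma4 {n : ℕ} (t : Fin n → MvPolynomial (Fin n) ℚ) (ht : IsTriangularSet t)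
    (hrad : (triIdeal t).IsRadical) (f u : (TriRing t)[X]) (hf : f.Monic) (hu : u.Monic)
    (huf : u ∣ f) :
    u ∈ Polynomial.lifts (locToTriRing t (badPrimes t f)) ∧
      ∀ p : ℕ, p.Prime → p ∣ den t u → ¬ IsRadicalPrime t p ∨ p ∣ den t f := by
  have hbad : ∀ p : ℕ, p.Prime → p ∣ den t u → ¬ IsRadicalPrime t p ∨ p ∣ den t f := by
    intro p hp hpu
    by_contra! h
    exact not_dvd_den ht hp (exists_reduced_not_dvd_den ht hf hu huf h.1 h.2) hpu
  refine ⟨?_, hbad⟩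
  have hmem : ∀ p : ℕ, p.Prime → p ∣ den t u → p ∈ badPrimes t f :=
    fun p hp hpu => ⟨hp, hbad p hp hpu⟩
  rw [Polynomial.lifts_iff_coeff_lifts]
  intro k
  obtain ⟨hpos, hclear⟩ := den_spec ht u
  obtain ⟨Q, -, hQ⟩ := hclear k
  -- A single denominator, `den t u`, serves for all coefficients; its prime factors lie in
  -- `badPrimes t f` by `hmem`.
  refine ⟨⟨MvPolynomial.C (den t u : ℚ)⁻¹ * MvPolynomial.map (Int.castRingHom ℚ) Q, den t u,
    Nat.mem_closure_of_forall_prime_dvd hpos.ne' hmem, hpos.ne', Q,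
    ?_⟩, ?_⟩
  · rw [← mul_assoc, ← map_mul, mul_inv_cancel₀ (Nat.cast_ne_zero.mpr hpos.ne'), map_one, one_mul]
  · exact mk_C_inv_mul hpos.ne' hQ
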